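/- Let $\Delta$ be a semiregular right-angled building with finite type set $I$, viewed as a chamber system: its Coxeter matrix satisfies $m_{ij}\in\{2,\infty\}$ for all distinct $i,j\in I$, and for each $i\in I$ all $i$-panels have the same (possibly infinite) cardinality $q_i\ge 2$. For each $i\in I$ let $X_i$ be a set of cardinality $q_i$, and let $\lambda=(\lambda_i)_{i\in I}\colon\Delta\to\prod_{i\in I}X_i$ be a legal colouring, i.e. on every $i$-panel $\mathcal P$ the map $\lambda_i|_{\mathcal P}\colon\mathcal P\to X_i$ is a bijection and $\lambda_j|_{\mathcal P}$ is constant for every $j\ne i$. For a type-preserving automorphism $g\in\mathrm{Aut}(\Delta)$ and an $i$-panel $\mathcal P$, the local action of $g$ at $\mathcal P$ is $\sigma_\lambda(g,\mathcal P)=\lambda_i|_{g\mathcal P}\circ g|_{\mathcal P}\circ(\lambda_i|_{\mathcal P})^{-1}\in\mathrm{Sym}(X_i)$. For each $i\in I$ let $F_i\le\mathrm{Sym}(X_i)$ be an arbitrary permutation group (a local group), and let $$\mathcal U(\boldsymbol F)=\{g\in\mathrm{Aut}(\Delta)\mid \sigma_\lambda(g,\mathcal P)\in F_i\text{ for every }i\in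 I\text{ and every }i\text{-panel }\mathcal P\}$$ be the universal group. Every permutation group $G\le\mathrm{Sym}(X)$ carries the permutation topology, in which the pointwise stabilisers in $G$ of the finite subsets of $X$ form a neighbourhood basis of the identity; $\mathrm{Aut}(\Delta)$ and $\mathcal U(\boldsymbol F)$ are regarded as permutation groups of the set of chambers of $\Delta$. A topological group is compactly generated if it is generated by a compact subset. Let $F_i^+$ denote the subgroup of $F_i$ generated by all point stabilisers $(F_i)_x$, $x\in X_i$. Assume that $\mathcal U(\boldsymbol F)$ is closed in $\mathrm{Aut}(\Delta)$, locally compact and compactly generated, and that $F_i^+$ is compactly generated for every $i\in I$. Then the local group $F_i$ is compactly generated for every $i\in I$. -/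

import Mathlib

/-! ### Permutation groups and the permutation topology -/

/-- The permutation topology on `Sym(X)`: the topology of pointwise convergence of maps `X → X`,
with `X` discrete.  A subgroup of `Sym(X)` carries the subspace topology. -/
instance permTopology (X : Type*) : TopologicalSpace (Equiv.Perm X) :=
  TopologicalSpace.induced (fun g : Equiv.Perm X => (g : X → X))
    (@Pi.topologicalSpace X (fun _ => X) (fun _ => ⊥))

theorem permTopology_hasBasis_nhds {X : Type*} (g : Equiv.Perm X) :
    (nhds g).HasBasis (fun _ : Finset X => True)
      (fun Φ => {h : Equiv.Perm X | ∀ x ∈ Φ, h x = g x}) := by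
  let _ : TopologicalSpace X := ⊥
  have : DiscreteTopology X := ⟨rfl⟩
  rw [nhds_induced, nhds_pi]
  simp only [nhds_discrete]
  constructor
  intro t
  simp only [Filter.mem_comap]
  constructor
  · rintro ⟨s, hs, hst⟩
    rw [Filter.mem_pi] at hs
    obtain ⟨J, hJ, u, hu, hus⟩ := hs
    refine ⟨hJ.toFinset, trivial, fun h hh => hst (hus ?_)⟩
    intro x hx
    have h1 := hh x (by simpa using hx)
    have h2 := hu x
    rw [Filter.mem_pure] at h2
    simpa only [h1] using h2
  · rintro ⟨Φ, -, hΦ⟩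
    refine ⟨Set.pi (Φ : Set X) (fun x => {g x}), ?_, ?_⟩
    · exact Filter.pi_mem_pi Φ.finite_toSet (fun x _ => by simp)
    · intro h hh
      exact hΦ (fun x hx => hh x hx)

/-- For a permutation group `G ≤ Sym(X)`, the pointwise stabilisers in `G` of the finite subsets
of `X` form a neighbourhood basis of the identity. -/
theorem permTopology_hasBasis_nhds_one {X : Type*} (G : Subgroup (Equiv.Perm X)) :
    (nhds (1 : G)).HasBasis (fun _ : Finset X => True)
      (fun Φ => {h : G | ∀ x ∈ Φ, (h : Equiv.Perm X) x = x}) := by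
  rw [nhds_subtype]
  exact (permTopology_hasBasis_nhds (1 : Equiv.Perm X)).comap _

/-- `Sym(X)` is a topological group for the permutation topology. -/
instance permTopology_isTopologicalGroup (X : Type*) : IsTopologicalGroup (Equiv.Perm X) where
  continuous_mul := by
    rw [continuous_iff_continuousAt]
    rintro ⟨g, h⟩
    unfold ContinuousAt
    rw [nhds_prod_eq]
    refine ((permTopology_hasBasis_nhds g).prod (permTopology_hasBasis_nhds h)).tendsto_iff
      (permTopology_hasBasis_nhds (g * h)) |>.2 fun Φ _ => ?_
    classical
    refine ⟨(Φ.image h, Φ), ⟨trivial, trivial⟩, ?_⟩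
    rintro ⟨a, b⟩ ⟨ha, hb⟩ x hx
    have h1 : b x = h x := hb x hx
    have h2 : a (h x) = g (h x) := ha (h x) (Finset.mem_image_of_mem h hx)
    simp [Equiv.Perm.mul_apply, h1, h2]
  continuous_inv := by
    rw [continuous_iff_continuousAt]
    intro g
    refine (permTopology_hasBasis_nhds g).tendsto_iff (permTopology_hasBasis_nhds g⁻¹) |>.2
      fun Φ _ => ?_
    classical
    refine ⟨Φ.image (g⁻¹ : Equiv.Perm X), trivial, ?_⟩
    intro a ha x hx
    have h1 : a (g⁻¹ x) = g (g⁻¹ x) := ha (g⁻¹ x) (Finset.mem_image_of_mem _ hx)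
    rw [Equiv.Perm.inv_eq_iff_eq, h1]
    simp

/-- A topological group is compactly generated if it is generated, as an abstract group, by a
compact subset. -/
def IsCompactlyGeneratedGroup (G : Type*) [Group G] [TopologicalSpace G] : Prop :=
  ∃ Q : Set G, IsCompact Q ∧ Subgroup.closure Q = ⊤

/-- `F⁺`: the subgroup of the permutation group `F ≤ Sym(X)` generated by all point stabilisers
in `F`. -/
def plusSubgroup {X : Type*} (F : Subgroup (Equiv.Perm X)) : Subgroup F :=
  Subgroup.closure {f : F | ∃ x : X, (f : Equiv.Perm X) x = x}

/-! ### Chamber systems and buildings -/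

/-- A chamber system over `I` with set of chambers `C`: an equivalence relation, `i`-adjacency,
for each `i ∈ I`. -/
structure ChamberSystem (I : Type*) (C : Type*) where
  adj : I → Setoid C

namespace ChamberSystem

variable {I C : Type*}

/-- The `i`-panel containing the chamber `c`. -/
def panel (Δ : ChamberSystem I C) (i : I) (c : C) : Set C :=
  {d | Δ.adj i c d}

/-- `Δ.Gallery ω c d`: there is a gallery of type `ω` from `c` to `d`.  Consecutive chambers of a
gallery are distinct. -/
inductive Gallery (Δ : ChamberSystem I C) : List I → C → C → Prop
  | nil (c : C) : Gallery Δ [] c c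
  | cons {i : I} {ω : List I} {c d e : C} :
      Δ.adj i c d → c ≠ d → Gallery Δ ω d e → Gallery Δ (i :: ω) c e

/-- `Δ` is a building of type `M`: it is non-empty, each panel contains at least two chambers, and
there is a distance function `δ` with values in the Coxeter group of type `M` such that, for each
reduced word `ω`, `δ c d` is the element represented by `ω` if and only if `c` and `d` are joined
by a gallery of type `ω`. -/
def IsBuilding (Δ : ChamberSystem I C) (M : CoxeterMatrix I) : Prop :=
  Nonempty C ∧
  (∀ (i : I) (c : C), ∃ d ∈ Δ.panel i c, d ≠ c) ∧
  ∃ δ : C → C → M.Group, ∀ (c d : C) (ω : List I), M.toCoxeterSystem.IsReduced ω →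
    (δ c d = M.toCoxeterSystem.wordProd ω ↔ Δ.Gallery ω c d)

/-- The group of type-preserving automorphisms: the permutations of the set of chambers that
preserve `i`-adjacency for all `i`. -/
def Aut (Δ : ChamberSystem I C) : Subgroup (Equiv.Perm C) where
  carrier := {g | ∀ (i : I) (c d : C), Δ.adj i (g c) (g d) ↔ Δ.adj i c d}
  one_mem' := fun _ _ _ => Iff.rfl
  mul_mem' := fun {g h} hg hh i c d => (hg i (h c) (h d)).trans (hh i c d)
  inv_mem' := fun {g} hg i c d => by
    have := hg i (g⁻¹ c) (g⁻¹ d)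
    simpa using this.symm

theorem image_mem_panel {Δ : ChamberSystem I C} (g : Δ.Aut) {i : I} {c d : C} :
    (g : Equiv.Perm C) d ∈ Δ.panel i ((g : Equiv.Perm C) c) ↔ d ∈ Δ.panel i c :=
  g.2 i c d

/-- The bijection from the `i`-panel of `c` to the `i`-panel of `g c` induced by an automorphism
`g`. -/
def panelMap {Δ : ChamberSystem I C} (g : Δ.Aut) (i : I) (c : C) :
    Δ.panel i c ≃ Δ.panel i ((g : Equiv.Perm C) c) :=
  (g : Equiv.Perm C).subtypeEquiv fun _ => (image_mem_panel g).symm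

end ChamberSystem

/-- A Coxeter matrix is right-angled if `m i j ∈ {2, ∞}` for all distinct `i`, `j`
(in Mathlib, the entry `0` stands for `∞`). -/
def CoxeterMatrix.IsRightAngled {I : Type*} (M : CoxeterMatrix I) : Prop :=
  ∀ i j : I, i ≠ j → M i j = 2 ∨ M i j = 0

/-! ### Legal colourings, local actions and universal groups -/

/-- A legal colouring of `Δ` with colour sets `X i`: on each `i`-panel, `color i` is a bijection to
`X i`, and `color j` is constant for `j ≠ i`. -/
structure LegalColouring {I C : Type*} (Δ : ChamberSystem I C) (X : I → Type*) where
  color : (i : I) → C → X i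
  bijOn : ∀ (i : I) (c : C), Set.BijOn (color i) (Δ.panel i c) Set.univ
  const : ∀ (i j : I), j ≠ i → ∀ c d : C, d ∈ Δ.panel i c → color j d = color j c

namespace LegalColouring

variable {I C : Type*} {Δ : ChamberSystem I C} {X : I → Type*}

/-- The bijection from the `i`-panel of `c` to `X i` given by the colouring. -/
noncomputable def panelEquiv (col : LegalColouring Δ X) (i : I) (c : C) : Δ.panel i c ≃ X i :=
  Equiv.ofBijective (fun d : Δ.panel i c => col.color i d)
    ⟨fun a b h => Subtype.ext ((col.bijOn i c).injOn a.2 b.2 h), fun x => by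
      obtain ⟨d, hd, hdx⟩ := (col.bijOn i c).surjOn (Set.mem_univ x)
      exact ⟨⟨d, hd⟩, hdx⟩⟩

/-- The local action of `g` at the `i`-panel `P` of `c`, i.e. the permutation
`color i |_(g P) ∘ g |_P ∘ (color i |_P)⁻¹` of `X i`. -/
noncomputable def localAction (col : LegalColouring Δ X) (g : Δ.Aut) (i : I) (c : C) :
    Equiv.Perm (X i) :=
  ((col.panelEquiv i c).symm.trans (ChamberSystem.panelMap g i c)).trans
    (col.panelEquiv i ((g : Equiv.Perm C) c))

theorem localAction_color (col : LegalColouring Δ X) (g : Δ.Aut) (i : I) (c d : C)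
    (hd : d ∈ Δ.panel i c) :
    col.localAction g i c (col.color i d) = col.color i ((g : Equiv.Perm C) d) := by
  have h : (col.panelEquiv i c).symm (col.color i d) = ⟨d, hd⟩ := by
    rw [Equiv.symm_apply_eq]; rfl
  simp only [localAction, Equiv.trans_apply, h]
  rfl

/-- The local action depends only on the panel, not on the chamber that represents it. -/
theorem localAction_congr (col : LegalColouring Δ X) (g : Δ.Aut) (i : I) (c c' : C)
    (h : c' ∈ Δ.panel i c) : col.localAction g i c' = col.localAction g i c := by
  ext x
  obtain ⟨d, hd, rfl⟩ := (col.bijOn i c').surjOn (Set.mem_univ x)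
  rw [localAction_color col g i c' d hd,
    localAction_color col g i c d ((Δ.adj i).trans' h hd)]

theorem localAction_one (col : LegalColouring Δ X) (i : I) (c : C) :
    col.localAction 1 i c = 1 := by
  ext x
  obtain ⟨d, hd, rfl⟩ := (col.bijOn i c).surjOn (Set.mem_univ x)
  rw [localAction_color col 1 i c d hd]
  rfl

theorem localAction_mul (col : LegalColouring Δ X) (g h : Δ.Aut) (i : I) (c : C) :
    col.localAction (g * h) i c =
      col.localAction g i ((h : Equiv.Perm C) c) * col.localAction h i c := by
  ext x
  obtain ⟨d, hd, rfl⟩ := (col.bijOn i c).surjOn (Set.mem_univ x)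
  rw [Equiv.Perm.mul_apply, localAction_color col (g * h) i c d hd,
    localAction_color col h i c d hd,
    localAction_color col g i _ _ ((ChamberSystem.image_mem_panel h).2 hd)]
  rfl

/-- The universal group `U(F)`: the automorphisms all of whose local actions at `i`-panels lie in
`F i`, for all `i`.  (The panels are represented by chambers that they contain.) -/
def universalGroup (col : LegalColouring Δ X) (F : (i : I) → Subgroup (Equiv.Perm (X i))) :
    Subgroup Δ.Aut where
  carrier := {g | ∀ (i : I) (c : C), col.localAction g i c ∈ F i}
  one_mem' := fun i c => by
    rw [localAction_one]; exact one_mem _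
  mul_mem' := fun {g h} hg hh i c => by
    rw [localAction_mul]; exact mul_mem (hg i _) (hh i c)
  inv_mem' := fun {g} hg i c => by
    have h := localAction_mul col g g⁻¹ i c
    rw [mul_inv_cancel, localAction_one] at h
    rw [eq_inv_of_mul_eq_one_right h.symm]
    exact inv_mem (hg i _)

end LegalColouring

/-! ### Reduced words in right-angled Coxeter groups -/

/-! Adjacent panels force compatibility: if two chambers c, d share a j-panel with j ≠ i, they have
the same i-colour, and so do their images under g. The local actions of g at the i-panels of c and d
thus agree on a colour, and differ by an element of a point stabiliser. By connectedness the local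
action is constant modulo F_i⁺ (`inv_localActionIn_mul_mem`), so it behaves as a homomorphism from
the universal group to F_i / F_i⁺, and elements agreeing on a chamber have the same image. A compact
generating set Q is covered by finitely many sets of elements agreeing on one chamber, so it has
finite image. Lifts of this image, together with a compact generating set of F_i⁺, generate F_i as
soon as the map is onto.

Surjectivity (`exists_localActionIn_eq`) is the hard part: each f in F_i must be the local action of
an automorphism at all i-panels, with trivial local actions of the other types. Such a map comes
from comparing the colouring with its recolouring by f, hence from the uniqueness of legal
colourings up to automorphism (`exists_aut_color_eq`). That is proved by following coloured words
from a base chamber: whether a word closes up depends only on the initial colours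
(`run_eq_self_of_run_eq_self`). A word that cannot be shortened by the obvious moves has tight type;
tight words are reduced (`IsTight.isReduced`), so the building axiom leaves only the empty closed
word. -/

namespace CoxeterMatrix

variable {I : Type*} (M : CoxeterMatrix I)

/-- A word is tight if it has no subword `s β s` all of whose inner letters commute with `s`. -/
def IsTight (ω : List I) : Prop :=
  ∀ (α : List I) (s : I) (β γ : List I), ω = α ++ s :: (β ++ s :: γ) → ∃ t ∈ β, M s t ≠ 2

variable {M} in
theorem IsTight.of_cons {s : I} {ω : List I} (h : M.IsTight (s :: ω)) : M.IsTight ω :=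
  fun α t β γ e => h (s :: α) t β γ (by rw [e]; rfl)

/-- The pairs of non-commuting letters (equal letters included) that involve the letter `s`. -/
def Involves (s a b : I) : Prop := M a b ≠ 2 ∧ (a = s ∨ b = s)

/-! ### An action of the right-angled Coxeter group on families of lists. -/

theorem involves_self (s : I) : M.Involves s s s := by simp [Involves]

open Classical in
/-- The number of leading letters `s` common to the lists attached to the pairs involving `s`. -/
noncomputable def lead (s : I) (P : I → I → List I) : ℕ :=
  sInf {n | ∃ a b, M.Involves s a b ∧ n = ((P a b).takeWhile (· = s)).length}

theorem lead_le {s a b : I} (P : I → I → List I) (h : M.Involves s a b) :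
    open Classical in M.lead s P ≤ ((P a b).takeWhile (· = s)).length :=
  Nat.sInf_le ⟨a, b, h, rfl⟩

theorem exists_lead_eq (s : I) (P : I → I → List I) :
    open Classical in ∃ a b, M.Involves s a b ∧
      M.lead s P = ((P a b).takeWhile (· = s)).length := by
  classical
  -- The pair (s, s) makes the set non-empty, so `sInf` is a genuine minimum and not the default
  -- value 0.
  have hne : {n | ∃ a b, M.Involves s a b ∧ n = ((P a b).takeWhile (· = s)).length}.Nonempty :=
    ⟨_, s, s, M.involves_self s, rfl⟩
  exact Nat.sInf_mem hne

theorem lead_congr {s : I} {P P' : I → I → List I}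
    (h : ∀ a b, M.Involves s a b → P a b = P' a b) : M.lead s P = M.lead s P' := by
  unfold lead
  congr 1
  ext n
  constructor
  · rintro ⟨a, b, hab, hn⟩
    exact ⟨a, b, hab, by rw [hn, h a b hab]⟩
  · rintro ⟨a, b, hab, hn⟩
    exact ⟨a, b, hab, by rw [hn, h a b hab]⟩

open Classical in
/-- The action of the simple reflection `s` on families of lists: according to the parity of the
number of common leading letters `s`, one letter `s` is removed from or added to all lists attached
to pairs involving `s`. -/
noncomputable def toggle (s : I) (P : I → I → List I) : I → I → List I := fun a b =>
  if M.Involves s a b then (if Odd (M.lead s P) then (P a b).tail else s :: P a b) else P a b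

/-- An odd minimum is positive, so each affected list begins with s and removing its head loses
nothing. -/
theorem cons_tail_of_odd {s a b : I} {P : I → I → List I} (h : M.Involves s a b)
    (hodd : Odd (M.lead s P)) : s :: (P a b).tail = P a b := by
  classical
  have h1 := M.lead_le P h
  have h2 := hodd.pos
  cases hP : P a b with
  | nil => rw [hP] at h1; simp at h1; omega
  | cons c l =>
    by_cases hc : c = s
    · simp [hc]
    · rw [hP] at h1; simp [hc] at h1; omega

theorem lead_toggle_of_odd {s : I} {P : I → I → List I} (hodd : Odd (M.lead s P)) :
    M.lead s (M.toggle s P) + 1 = M.lead s P := by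
  classical
  have key : ∀ a b, M.Involves s a b → ((M.toggle s P a b).takeWhile (· = s)).length + 1 =
      ((P a b).takeWhile (· = s)).length := by
    intro a b h
    rw [← M.cons_tail_of_odd h hodd]
    simp [toggle, h, hodd]
  obtain ⟨a, b, h, e⟩ := M.exists_lead_eq s P
  obtain ⟨a', b', h', e'⟩ := M.exists_lead_eq s (M.toggle s P)
  have h1 := M.lead_le (M.toggle s P) h
  have h2 := M.lead_le P h'
  have := key a b h
  have := key a' b' h'
  omega

theorem lead_toggle_of_not_odd {s : I} {P : I → I → List I} (hodd : ¬ Odd (M.lead s P)) :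
    M.lead s (M.toggle s P) = M.lead s P + 1 := by
  classical
  have key : ∀ a b, M.Involves s a b → ((M.toggle s P a b).takeWhile (· = s)).length =
      ((P a b).takeWhile (· = s)).length + 1 := by
    intro a b h
    simp [toggle, h, hodd]
  obtain ⟨a, b, h, e⟩ := M.exists_lead_eq s P
  obtain ⟨a', b', h', e'⟩ := M.exists_lead_eq s (M.toggle s P)
  have h1 := M.lead_le (M.toggle s P) h
  have h2 := M.lead_le P h'
  have := key a b h
  have := key a' b' h'
  omega

/-- Each toggle changes the minimum by exactly one, hence flips its parity; the second toggle
therefore undoes the first. -/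
theorem toggle_toggle (s : I) (P : I → I → List I) : M.toggle s (M.toggle s P) = P := by
  funext a b
  by_cases h : M.Involves s a b
  · by_cases hodd : Odd (M.lead s P)
    · have h1 : ¬ Odd (M.lead s (M.toggle s P)) := by
        have := M.lead_toggle_of_odd hodd
        rw [← this] at hodd
        intro h2
        rw [Nat.odd_add_one] at hodd
        exact hodd h2
      have h2 : M.toggle s P a b = (P a b).tail := by simp [toggle, h, hodd]
      rw [toggle, if_pos h, if_neg h1, h2, M.cons_tail_of_odd h hodd]
    · have h1 : Odd (M.lead s (M.toggle s P)) := by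
        rw [M.lead_toggle_of_not_odd hodd, Nat.odd_add_one]
        exact hodd
      rw [toggle, if_pos h, if_pos h1]
      simp [toggle, h, hodd]
  · simp [toggle, h]

theorem not_involves_of_commute {s t a b : I} (hst : M s t = 2) (h : M.Involves s a b) :
    ¬ M.Involves t a b := by
  have hts : M t s = 2 := by rw [M.symmetric, hst]
  have hne : s ≠ t := by rintro rfl; simp at hst
  rintro ⟨h1, h2⟩
  obtain ⟨-, h3⟩ := h
  rcases h2 with rfl | rfl <;> rcases h3 with rfl | rfl <;> first | exact hne rfl | exact h1 hst | exact h1 hts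

/-- Commuting letters act on disjoint sets of coordinates: a pair involving both would consist of s
and t, which commute. -/
theorem toggle_comm {s t : I} (hst : M s t = 2) (P : I → I → List I) :
    M.toggle s (M.toggle t P) = M.toggle t (M.toggle s P) := by
  have hts : M t s = 2 := by rw [M.symmetric, hst]
  have e1 : M.lead s (M.toggle t P) = M.lead s P := M.lead_congr fun a b h => by
    simp [toggle, M.not_involves_of_commute hst h]
  have e2 : M.lead t (M.toggle s P) = M.lead t P := M.lead_congr fun a b h => by
    simp [toggle, M.not_involves_of_commute hts h]
  funext a b
  by_cases h : M.Involves s a b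
  · have h' := M.not_involves_of_commute hst h
    simp [toggle, h, h', e1]
  · by_cases h' : M.Involves t a b
    · simp [toggle, h, h', e2]
    · simp [toggle, h, h']

/-- The action of a simple reflection, as an element of the endomorphism monoid. -/
noncomputable def toggleEnd (s : I) : Function.End (I → I → List I) := M.toggle s

theorem isLiftable_toggleEnd (hM : M.IsRightAngled) : M.IsLiftable M.toggleEnd := by
  intro s t
  have hsq : ∀ r, M.toggleEnd r * M.toggleEnd r = 1 :=
    fun r => funext fun P => M.toggle_toggle r P
  by_cases hst : s = t
  · subst hst
    rw [M.diagonal, pow_one]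
    exact hsq s
  · rcases hM s t hst with h | h
    · have hc : M.toggleEnd s * M.toggleEnd t = M.toggleEnd t * M.toggleEnd s :=
        funext fun P => M.toggle_comm h P
      rw [h, pow_two]
      nth_rw 2 [hc]
      rw [mul_assoc, ← mul_assoc (M.toggleEnd t) (M.toggleEnd t), hsq t, one_mul, hsq s]
    · rw [h, pow_zero]

/-! ### Tight words are recovered from the action. -/

open Classical in
/-- The projections of a word to the pairs of non-commuting letters. -/
noncomputable def projections (ω : List I) : I → I → List I := fun a b =>
  if M a b ≠ 2 then ω.filter (fun c => c = a ∨ c = b) else []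

/-- If every affected list began with s, then s would occur in ω, and tightness would give a letter
t before its first occurrence that does not commute with s. The list at (s, t) then begins with a
letter preceding every s, a contradiction. -/
theorem lead_projections_of_isTight {s : I} {ω : List I} (h : M.IsTight (s :: ω)) :
    M.lead s (M.projections ω) = 0 := by
  classical
  by_contra hne
  have key : ∀ a b, M.Involves s a b → ∃ l, M.projections ω a b = s :: l := by
    intro a b hab
    have h1 := M.lead_le (M.projections ω) hab
    cases hP : M.projections ω a b with
    | nil => rw [hP] at h1; simp at h1; omega
    | cons c l =>
      by_cases hc : c = s
      · exact ⟨l, by rw [hc]⟩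
      · rw [hP] at h1; simp [hc] at h1; omega
  have hs : s ∈ ω := by
    obtain ⟨l, hl⟩ := key s s (M.involves_self s)
    have : s ∈ M.projections ω s s := by rw [hl]; simp
    simp only [projections] at this
    split_ifs at this
    · exact List.mem_of_mem_filter this
    · simp at this
  obtain ⟨α, β, hω, hα⟩ := List.eq_append_cons_of_mem hs
  obtain ⟨t, ht, hst⟩ := h [] s α β (by rw [hω]; rfl)
  obtain ⟨l, hl⟩ := key s t ⟨hst, Or.inl rfl⟩
  rw [projections, if_pos hst, hω, List.filter_append] at hl
  cases hf : α.filter (fun c => c = s ∨ c = t) with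
  | nil =>
    have : t ∈ α.filter (fun c => c = s ∨ c = t) := by simp [ht]
    rw [hf] at this
    simp at this
  | cons c l' =>
    rw [hf] at hl
    simp only [List.cons_append, List.cons.injEq] at hl
    have : c ∈ α.filter (fun c => c = s ∨ c = t) := by rw [hf]; simp
    rw [hl.1] at this
    exact hα (List.mem_of_mem_filter this)

theorem toggle_projections {s : I} {ω : List I} (h : M.IsTight (s :: ω)) :
    M.toggle s (M.projections ω) = M.projections (s :: ω) := by
  funext a b
  have h0 : ¬ Odd (M.lead s (M.projections ω)) := by
    rw [M.lead_projections_of_isTight h]; simp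
  by_cases hab : M.Involves s a b
  · rw [toggle, if_pos hab, if_neg h0]
    obtain ⟨h1, h2⟩ := hab
    simp only [projections, if_pos h1]
    rw [List.filter_cons_of_pos]
    simpa [eq_comm] using h2
  · rw [toggle, if_neg hab]
    simp only [projections]
    split_ifs with h1
    · rw [List.filter_cons_of_neg]
      have : ¬ (a = s ∨ b = s) := fun h2 => hab ⟨h1, h2⟩
      simpa [eq_comm] using this
    · rfl

/-- The action of the right-angled Coxeter group on families of lists. -/
noncomputable def toggleHom (hM : M.IsRightAngled) :
    M.Group →* Function.End (I → I → List I) :=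
  M.toCoxeterSystem.lift ⟨M.toggleEnd, M.isLiftable_toggleEnd hM⟩

theorem toggleHom_wordProd_cons (hM : M.IsRightAngled) (s : I) (ω : List I)
    (P : I → I → List I) :
    M.toggleHom hM (M.toCoxeterSystem.wordProd (s :: ω)) P =
      M.toggle s (M.toggleHom hM (M.toCoxeterSystem.wordProd ω) P) := by
  rw [CoxeterSystem.wordProd_cons, map_mul]
  have : M.toggleHom hM (M.toCoxeterSystem.simple s) = M.toggleEnd s :=
    M.toCoxeterSystem.lift_apply_simple (M.isLiftable_toggleEnd hM) s
  rw [this]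
  rfl

/-- By tightness every toggle, read from the right, meets the even value 0 and adds a letter. Thus
the group element alone determines the projections of a tight word. -/
theorem toggleHom_of_isTight (hM : M.IsRightAngled) {ω : List I} (h : M.IsTight ω) :
    M.toggleHom hM (M.toCoxeterSystem.wordProd ω) (fun _ _ => []) = M.projections ω := by
  induction ω with
  | nil =>
    rw [CoxeterSystem.wordProd_nil, map_one]
    funext a b
    simp [projections, Function.End.one_def]
  | cons s ω ih =>
    rw [toggleHom_wordProd_cons, ih h.of_cons, M.toggle_projections h]

-- The diagonal list at s changes only under the letter s, and grows by at most one each time. This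
-- bounds from below the number of letters s in any word for a given element.
open Classical in
theorem length_toggleHom_diag_le (hM : M.IsRightAngled) (ω : List I) (s : I) :
    (M.toggleHom hM (M.toCoxeterSystem.wordProd ω) (fun _ _ => []) s s).length ≤ ω.count s := by
  induction ω with
  | nil =>
    rw [CoxeterSystem.wordProd_nil, map_one]
    simp [Function.End.one_def]
  | cons t ω ih =>
    rw [toggleHom_wordProd_cons]
    by_cases hts : t = s
    · subst hts
      rw [toggle, if_pos (M.involves_self t), List.count_cons_self]
      split_ifs
      · rw [List.length_tail]; omega
      · rw [List.length_cons]; omega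
    · rw [toggle, if_neg (fun h => hts (by rcases h.2 with h | h <;> exact h.symm)),
        List.count_cons_of_ne hts]
      exact ih

variable {M} in
/-- In a right-angled Coxeter group, tight words are reduced. -/
theorem IsTight.isReduced (hM : M.IsRightAngled) {ω : List I} (h : M.IsTight ω) :
    M.toCoxeterSystem.IsReduced ω := by
  classical
  -- A reduced word for the same element contains each letter at least as often as the tight word,
  -- so it is at least as long.
  obtain ⟨ω', hω', e⟩ := M.toCoxeterSystem.exists_isReduced (M.toCoxeterSystem.wordProd ω)
  have hcount : ∀ s, ω.count s ≤ ω'.count s := by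
    intro s
    have h1 := M.length_toggleHom_diag_le hM ω' s
    rw [← e, M.toggleHom_of_isTight hM h] at h1
    refine le_trans (le_of_eq ?_) h1
    simp only [projections, M.diagonal, ne_eq, OfNat.one_ne_ofNat, not_false_eq_true, if_true,
      or_self]
    rw [List.count_eq_length_filter]
    rfl
  have hle : (ω : Multiset I) ≤ (ω' : Multiset I) :=
    Multiset.le_iff_count.2 fun s => by simpa using hcount s
  have hlen : ω.length ≤ ω'.length := by simpa using Multiset.card_le_card hle
  refine le_antisymm (M.toCoxeterSystem.length_wordProd_le ω) ?_
  rw [e, hω'.eq]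
  exact hlen

end CoxeterMatrix

/-! ### Moving along coloured words -/

namespace LegalColouring

variable {I C : Type*} {Δ : ChamberSystem I C} {X : I → Type*}

/-- The chamber of colour `p.2` in the panel of type `p.1` of `c`. -/
noncomputable def step (col : LegalColouring Δ X) (c : C) (p : Σ j, X j) : C :=
  (col.panelEquiv p.1 c).symm p.2

theorem adj_step (col : LegalColouring Δ X) (c : C) (p : Σ j, X j) :
    Δ.adj p.1 c (col.step c p) :=
  ((col.panelEquiv p.1 c).symm p.2).2

theorem color_step_self (col : LegalColouring Δ X) (c : C) (p : Σ j, X j) :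
    col.color p.1 (col.step c p) = p.2 :=
  (col.panelEquiv p.1 c).apply_symm_apply p.2

theorem color_step_of_ne (col : LegalColouring Δ X) (c : C) (p : Σ j, X j) {k : I}
    (h : k ≠ p.1) : col.color k (col.step c p) = col.color k c :=
  col.const p.1 k h c _ (col.adj_step c p)

theorem eq_of_adj (col : LegalColouring Δ X) {j : I} {c d : C} (h : Δ.adj j c d)
    (hc : col.color j c = col.color j d) : c = d :=
  (col.bijOn j c).injOn ((Δ.adj j).refl c) h hc

theorem step_eq_of_adj (col : LegalColouring Δ X) {c d : C} {p : Σ j, X j} (h : Δ.adj p.1 c d)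
    (hp : col.color p.1 d = p.2) : col.step c p = d :=
  col.eq_of_adj ((Δ.adj p.1).trans' ((Δ.adj p.1).symm' (col.adj_step c p)) h)
    (by rw [color_step_self, hp])

theorem step_eq_self (col : LegalColouring Δ X) {c : C} {p : Σ j, X j}
    (hp : col.color p.1 c = p.2) : col.step c p = c :=
  col.step_eq_of_adj ((Δ.adj p.1).refl c) hp

theorem step_step_self (col : LegalColouring Δ X) (c : C) {p q : Σ j, X j} (h : p.1 = q.1) :
    col.step (col.step c p) q = col.step c q := by
  refine col.step_eq_of_adj ?_ (col.color_step_self c q)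
  have h1 := col.adj_step c p
  rw [h] at h1
  exact (Δ.adj q.1).trans' ((Δ.adj q.1).symm' h1) (col.adj_step c q)

/-- When both steps are proper they form a gallery of type ij. The words ij and ji are reduced and
represent the same element, so the building axiom yields a gallery of type ji with the same ends,
and the colours identify its middle chamber. -/
theorem step_comm {M : CoxeterMatrix I} (hM : M.IsRightAngled) (hΔ : Δ.IsBuilding M)
    (col : LegalColouring Δ X) (c : C) {p q : Σ j, X j} (h : M p.1 q.1 = 2) :
    col.step (col.step c p) q = col.step (col.step c q) p := by
  have hne : p.1 ≠ q.1 := by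
    intro e
    rw [e, M.diagonal] at h
    simp at h
  by_cases h1 : col.color p.1 c = p.2
  · rw [col.step_eq_self h1, col.step_eq_self (p := p)]
    rw [col.color_step_of_ne c q hne, h1]
  by_cases h2 : col.color q.1 c = q.2
  · rw [col.step_eq_self h2, col.step_eq_self (p := q)]
    rw [col.color_step_of_ne c p hne.symm, h2]
  obtain ⟨-, -, δ, hδ⟩ := hΔ
  have hred : ∀ j k : I, j ≠ k → M.toCoxeterSystem.IsReduced [j, k] := by
    intro j k hjk
    refine CoxeterMatrix.IsTight.isReduced hM ?_
    intro α s β γ e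
    exfalso
    match α, β, e with
    | [], [], e => simp at e; exact hjk (e.1.trans e.2.1.symm)
    | [], b :: β, e => simp at e
    | [a], β, e => simp at e
    | a :: b :: α, β, e => simp at e
  have hcomm : M.toCoxeterSystem.wordProd [p.1, q.1] = M.toCoxeterSystem.wordProd [q.1, p.1] := by
    have e := M.toCoxeterSystem.simple_mul_simple_pow p.1 q.1
    rw [h, pow_two, mul_eq_one_iff_eq_inv, mul_inv_rev, CoxeterSystem.inv_simple,
      CoxeterSystem.inv_simple] at e
    simpa [CoxeterSystem.wordProd] using e
  have hg : Δ.Gallery [p.1, q.1] c (col.step (col.step c p) q) := by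
    refine .cons (col.adj_step c p) ?_ (.cons (col.adj_step _ q) ?_ (.nil _))
    · intro e
      exact h1 (by rw [e, color_step_self])
    · intro e
      refine h2 ?_
      rw [← col.color_step_of_ne c p hne.symm, e, color_step_self]
  rw [← hδ _ _ _ (hred _ _ hne), hcomm, hδ _ _ _ (hred _ _ hne.symm)] at hg
  generalize he : col.step (col.step c p) q = e at hg
  cases hg with
  | @cons _ _ _ d _ hcd _ hg =>
    cases hg with
    | @cons _ _ _ e' _ hde _ hg =>
      cases hg
      have e1 : col.step c q = d := by
        refine col.step_eq_of_adj hcd ?_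
        rw [← col.const p.1 q.1 hne.symm d e hde, ← he, color_step_self]
      rw [e1]
      refine (col.step_eq_of_adj hde ?_).symm
      rw [← he, col.color_step_of_ne _ q hne, color_step_self]

/-- The chamber reached from `c` by moving along a coloured word. -/
noncomputable def run (col : LegalColouring Δ X) (c : C) (w : List (Σ j, X j)) : C :=
  w.foldl col.step c

@[simp] theorem run_nil (col : LegalColouring Δ X) (c : C) : col.run c [] = c := rfl

@[simp] theorem run_cons (col : LegalColouring Δ X) (c : C) (p : Σ j, X j)
    (w : List (Σ j, X j)) : col.run c (p :: w) = col.run (col.step c p) w := rfl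

@[simp] theorem run_append (col : LegalColouring Δ X) (c : C) (w v : List (Σ j, X j)) :
    col.run c (w ++ v) = col.run (col.run c w) v :=
  List.foldl_append

theorem run_step_comm {M : CoxeterMatrix I} (hM : M.IsRightAngled) (hΔ : Δ.IsBuilding M)
    (col : LegalColouring Δ X) {p : Σ j, X j} (w : List (Σ j, X j))
    (h : ∀ q ∈ w, M p.1 q.1 = 2) (c : C) :
    col.run (col.step c p) w = col.step (col.run c w) p := by
  induction w generalizing c with
  | nil => rfl
  | cons q w ih =>
    rw [run_cons, step_comm hM hΔ col c (h q (by simp)), ih (fun r hr => h r (by simp [hr])),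
      run_cons]

theorem exists_run_eq {M : CoxeterMatrix I} (hΔ : Δ.IsBuilding M)
    (col : LegalColouring Δ X) (c d : C) : ∃ w, col.run c w = d := by
  obtain ⟨-, -, δ, hδ⟩ := hΔ
  obtain ⟨ω, hω, e⟩ := M.toCoxeterSystem.exists_isReduced (δ c d)
  have hg := (hδ c d ω hω).1 e
  clear e hω
  induction hg with
  | nil c => exact ⟨[], rfl⟩
  | @cons i ω c d e h _ _ ih =>
    obtain ⟨w, hw⟩ := ih
    exact ⟨⟨i, col.color i d⟩ :: w, by rw [run_cons, col.step_eq_of_adj h rfl, hw]⟩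

/-! ### Transporting coloured words between legal colourings. -/

theorem color_step_eq {col col' : LegalColouring Δ X} {c c' : C}
    (h : ∀ j, col.color j c = col'.color j c') (p : Σ j, X j) (j : I) :
    col.color j (col.step c p) = col'.color j (col'.step c' p) := by
  by_cases hj : j = p.1
  · subst hj
    rw [color_step_self, color_step_self]
  · rw [color_step_of_ne _ _ _ hj, color_step_of_ne _ _ _ hj, h]

theorem color_run_eq {col col' : LegalColouring Δ X} {c c' : C}
    (h : ∀ j, col.color j c = col'.color j c') (w : List (Σ j, X j)) :
    ∀ j, col.color j (col.run c w) = col'.color j (col'.run c' w) := by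
  induction w generalizing c c' with
  | nil => exact h
  | cons p w ih => exact ih (color_step_eq h p)

/-- A coloured word all of whose letters change the colour defines a gallery. -/
theorem gallery_run (col : LegalColouring Δ X) (w : List (Σ j, X j)) (c : C)
    (h : ∀ v p u, w = v ++ p :: u → col.color p.1 (col.run c v) ≠ p.2) :
    Δ.Gallery (w.map Sigma.fst) c (col.run c w) := by
  induction w generalizing c with
  | nil => exact .nil c
  | cons p w ih =>
    refine .cons (col.adj_step c p) ?_ (ih _ ?_)
    · intro e
      exact h [] p w rfl (by rw [run_nil, e, color_step_self])
    · intro v q u e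
      exact h (p :: v) q u (by rw [e]; rfl)

/-- Whether a coloured word is closed only depends on the colours of the initial chamber. -/
theorem run_eq_self_of_run_eq_self {M : CoxeterMatrix I} (hM : M.IsRightAngled)
    (hΔ : Δ.IsBuilding M) {col col' : LegalColouring Δ X} {c c' : C}
    (h : ∀ j, col.color j c = col'.color j c') (w : List (Σ j, X j)) (hw : col.run c w = c) :
    col'.run c' w = c' := by
  induction hn : w.length using Nat.strong_induction_on generalizing w with
  | _ n ih =>
  subst hn
  by_cases h1 : ∀ v p u, w = v ++ p :: u → col.color p.1 (col.run c v) ≠ p.2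
  -- With every letter proper and the type tight, the closed gallery has reduced type, so its length
  -- is that of δ c c = 1 and the word is empty.
  · by_cases h2 : M.IsTight (w.map Sigma.fst)
    · have hg := col.gallery_run w c h1
      rw [hw] at hg
      obtain ⟨-, -, δ, hδ⟩ := hΔ
      have hred := h2.isReduced hM
      have e1 := (hδ c c _ hred).2 hg
      have hnil : M.toCoxeterSystem.IsReduced [] := by simp [CoxeterSystem.IsReduced]
      have e2 := (hδ c c [] hnil).2 (.nil c)
      have e3 := hred.eq
      rw [← e1, e2] at e3
      have : w = [] := by simpa using e3.symm
      rw [this, run_nil]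
    · simp only [CoxeterMatrix.IsTight, not_forall, not_exists, not_and, not_not] at h2
      obtain ⟨α, s, β, γ, e, hβ⟩ := h2
      obtain ⟨a, w₁, rfl, -, e₁⟩ := List.map_eq_append_iff.1 e
      obtain ⟨p, w₂, rfl, hp, e₂⟩ := List.map_eq_cons_iff.1 e₁
      obtain ⟨b, w₃, rfl, rfl, e₃⟩ := List.map_eq_append_iff.1 e₂
      obtain ⟨q, g, rfl, hq, -⟩ := List.map_eq_cons_iff.1 e₃
      have hpb : ∀ r ∈ b, M p.1 r.1 = 2 := by
        intro r hr
        rw [hp]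
        exact hβ r.1 (List.mem_map_of_mem hr)
      -- The letter p can be moved past b to meet q of the same type, which overwrites it. So p may
      -- be deleted for any colouring and any starting chamber.
      have key : ∀ (col : LegalColouring Δ X) (c : C),
          col.run c (a ++ p :: (b ++ q :: g)) = col.run c (a ++ (b ++ q :: g)) := by
        intro col c
        simp only [run_append, run_cons]
        rw [run_step_comm hM hΔ col b hpb, step_step_self _ _ (hp.trans hq.symm)]
      rw [key]
      rw [key] at hw
      exact ih _ (by simp) _ hw rfl
  · push Not at h1
    obtain ⟨v, p, u, rfl, hp⟩ := h1
    -- Whether a letter is idle is decided by colours alone, so it can be deleted on both sides.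
    have hp' : col'.color p.1 (col'.run c' v) = p.2 := by rw [← color_run_eq h, hp]
    rw [run_append, run_cons, col'.step_eq_self hp', ← run_append]
    rw [run_append, run_cons, col.step_eq_self hp, ← run_append] at hw
    exact ih _ (by simp) _ hw rfl

/-- Choose a return word u from the common end to c. Both v followed by u (from c) and u followed by
w (from the common end) are closed, and closedness transfers. -/
theorem run_eq_run_of_run_eq_run {M : CoxeterMatrix I} (hM : M.IsRightAngled)
    (hΔ : Δ.IsBuilding M) {col col' : LegalColouring Δ X} {c c' : C}
    (h : ∀ j, col.color j c = col'.color j c') {w v : List (Σ j, X j)}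
    (hw : col.run c w = col.run c v) : col'.run c' w = col'.run c' v := by
  obtain ⟨u, hu⟩ := exists_run_eq hΔ col (col.run c v) c
  have e1 : col'.run c' (v ++ u) = c' :=
    run_eq_self_of_run_eq_self hM hΔ h _ (by rw [run_append, hu])
  have e2 : col'.run (col'.run c' v) (u ++ w) = col'.run c' v :=
    run_eq_self_of_run_eq_self hM hΔ (color_run_eq h v) _ (by rw [run_append, hu, hw])
  rw [run_append] at e1 e2
  rwa [e1] at e2

/-- Two legal colourings with the same colour sets are conjugate under an automorphism, which may
be prescribed on one chamber in accordance with the colours. -/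
theorem exists_aut_color_eq {M : CoxeterMatrix I} (hM : M.IsRightAngled)
    (hΔ : Δ.IsBuilding M) {col col' : LegalColouring Δ X} {c c' : C}
    (h : ∀ j, col.color j c = col'.color j c') :
    ∃ g : Δ.Aut, ∀ j d, col'.color j ((g : Equiv.Perm C) d) = col.color j d := by
  have h' : ∀ j, col'.color j c' = col.color j c := fun j => (h j).symm
  choose w hw using exists_run_eq hΔ col c
  choose w' hw' using exists_run_eq hΔ col' c'
  have adj : ∀ {col col' : LegalColouring Δ X} {c c' : C}
      (_ : ∀ j, col.color j c = col'.color j c') (w : C → List (Σ j, X j))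
      (_ : ∀ d, col.run c (w d) = d) (j : I) (d e : C), Δ.adj j d e →
      Δ.adj j (col'.run c' (w d)) (col'.run c' (w e)) := by
    intro col col' c c' h w hw j d e hde
    have e1 : col.run c (w e) = col.run c (w d ++ [⟨j, col.color j e⟩]) := by
      rw [run_append, hw, hw, run_cons, run_nil, col.step_eq_of_adj hde rfl]
    rw [run_eq_run_of_run_eq_run hM hΔ h e1, run_append]
    exact col'.adj_step _ _
  -- The automorphism sends the end of a coloured word from c to the end of the same word from c';
  -- independence of the chosen word gives the inverse laws.
  let g : Equiv.Perm C :=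
    { toFun := fun d => col'.run c' (w d)
      invFun := fun d => col.run c (w' d)
      left_inv := fun d => by
        refine (run_eq_run_of_run_eq_run hM hΔ h' ?_).trans (hw d)
        exact hw' _
      right_inv := fun d => by
        refine (run_eq_run_of_run_eq_run hM hΔ h ?_).trans (hw' d)
        exact hw _ }
  refine ⟨⟨g, fun j d e => ⟨fun hde => ?_, adj h w hw j d e⟩⟩, fun j d => ?_⟩
  · have := adj h' w' hw' j _ _ hde
    change Δ.adj j (g.symm (g d)) (g.symm (g e)) at this
    simpa using this
  · change col'.color j (col'.run c' (w d)) = _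
    rw [← color_run_eq h, hw]

/-- Recolouring a legal colouring by permutations of the colour sets. -/
def recolour (col : LegalColouring Δ X) (φ : ∀ j, Equiv.Perm (X j)) : LegalColouring Δ X where
  color j c := φ j (col.color j c)
  bijOn j c := (Set.bijOn_univ.2 (φ j).bijective).comp (col.bijOn j c)
  const j k hk c d hd := by rw [col.const j k hk c d hd]

/-- Every permutation of the colours of type `i` is induced by an automorphism that preserves all
other colours. -/
theorem exists_aut_localAction_eq {M : CoxeterMatrix I} (hM : M.IsRightAngled)
    (hΔ : Δ.IsBuilding M) (col : LegalColouring Δ X) (i : I) (f : Equiv.Perm (X i)) :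
    ∃ g : Δ.Aut, (∀ c, col.localAction g i c = f) ∧
      ∀ j, j ≠ i → ∀ c, col.localAction g j c = 1 := by
  classical
  obtain ⟨c⟩ := hΔ.1
  -- The image of c must have the recoloured colours of c; the chamber of colour f(λ_i(c)) in its
  -- own i-panel has them.
  have hcol : ∀ j, (col.recolour (Pi.mulSingle i f)).color j c =
      col.color j (col.step c ⟨i, f (col.color i c)⟩) := by
    intro j
    by_cases hj : j = i
    · subst hj
      refine Eq.trans ?_ (col.color_step_self c ⟨j, f (col.color j c)⟩).symm
      simp [recolour]
    · rw [color_step_of_ne _ _ _ hj]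
      simp [recolour, hj]
  obtain ⟨g, hg⟩ := exists_aut_color_eq hM hΔ hcol
  have hloc : ∀ j c, col.localAction g j c = Pi.mulSingle (M := fun j => Equiv.Perm (X j)) i f j := by
    intro j c
    ext x
    obtain ⟨d, hd, rfl⟩ := (col.bijOn j c).surjOn (Set.mem_univ x)
    rw [localAction_color col g j c d hd, hg]
    rfl
  refine ⟨g, fun c => ?_, fun j hj c => ?_⟩
  · rw [hloc]; simp
  · rw [hloc]; simp [hj]

end LegalColouring

/-! ### Compact generation of the local groups -/

theorem mem_plusSubgroup_of_apply_eq_self {X : Type*} {F : Subgroup (Equiv.Perm X)} {f : F} {x : X}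
    (h : (f : Equiv.Perm X) x = x) : f ∈ plusSubgroup F :=
  Subgroup.subset_closure ⟨x, h⟩

namespace LegalColouring

variable {I C : Type*} {Δ : ChamberSystem I C} {X : I → Type*}

/-- The local action of an element of the universal group, as an element of the local group. -/
noncomputable def localActionIn (col : LegalColouring Δ X)
    {F : (i : I) → Subgroup (Equiv.Perm (X i))} (g : col.universalGroup F) (i : I) (c : C) : F i :=
  ⟨col.localAction g i c, g.2 i c⟩

theorem localActionIn_mul (col : LegalColouring Δ X) {F : (i : I) → Subgroup (Equiv.Perm (X i))}
    (g h : col.universalGroup F) (i : I) (c : C) :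
    col.localActionIn (g * h) i c =
      col.localActionIn g i (((h : Δ.Aut) : Equiv.Perm C) c) * col.localActionIn h i c :=
  Subtype.ext (col.localAction_mul g h i c)

theorem localActionIn_one (col : LegalColouring Δ X) {F : (i : I) → Subgroup (Equiv.Perm (X i))}
    (i : I) (c : C) : col.localActionIn (1 : col.universalGroup F) i c = 1 :=
  Subtype.ext (col.localAction_one i c)

/-- The local actions at any two panels of type `i` agree modulo the subgroup generated by the
point stabilisers. -/
theorem inv_localActionIn_mul_mem {M : CoxeterMatrix I} (hΔ : Δ.IsBuilding M)
    (col : LegalColouring Δ X) {F : (i : I) → Subgroup (Equiv.Perm (X i))}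
    (g : col.universalGroup F) (i : I) (c d : C) :
    (col.localActionIn g i c)⁻¹ * col.localActionIn g i d ∈ plusSubgroup (F i) := by
  obtain ⟨w, rfl⟩ := exists_run_eq hΔ col c d
  induction w generalizing c with
  | nil => rw [run_nil, inv_mul_cancel]; exact one_mem _
  | cons p w ih =>
    have key : (col.localActionIn g i c)⁻¹ * col.localActionIn g i (col.step c p) ∈
        plusSubgroup (F i) := by
      have hadj := col.adj_step c p
      generalize col.step c p = d at hadj
      by_cases hi : i = p.1
      · subst hi
        have : col.localActionIn g p.1 d = col.localActionIn g p.1 c :=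
          Subtype.ext (col.localAction_congr g p.1 c d hadj)
        rw [this, inv_mul_cancel]
        exact one_mem _
      -- The chambers c and d share a panel of type other than i, and so do their images, so both
      -- local actions send the common i-colour to the same colour.
      · refine mem_plusSubgroup_of_apply_eq_self (x := col.color i d) ?_
        have e1 : col.localAction g i d (col.color i d) = col.color i (((g : Δ.Aut) : Equiv.Perm C) d) :=
          col.localAction_color g i d d ((Δ.adj i).refl d)
        have e2 : col.localAction g i c (col.color i c) = col.color i (((g : Δ.Aut) : Equiv.Perm C) c) :=
          col.localAction_color g i c c ((Δ.adj i).refl c)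
        rw [col.const p.1 i hi _ _ ((ChamberSystem.image_mem_panel (g : Δ.Aut)).2 hadj), ← e2,
          ← col.const p.1 i hi c d hadj] at e1
        change (col.localAction g i c)⁻¹ (col.localAction g i d (col.color i d)) = _
        exact Equiv.Perm.inv_eq_iff_eq.2 e1
    have := mul_mem key (ih (col.step c p))
    rwa [mul_assoc, mul_inv_cancel_left] at this

/-- Every element of the local group of type `i` is a local action of an element of the universal
group. -/
theorem exists_localActionIn_eq {M : CoxeterMatrix I} (hM : M.IsRightAngled)
    (hΔ : Δ.IsBuilding M) (col : LegalColouring Δ X) (F : (i : I) → Subgroup (Equiv.Perm (X i)))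
    (i : I) (c : C) (f : F i) : ∃ g : col.universalGroup F, col.localActionIn g i c = f := by
  obtain ⟨g, h1, h2⟩ := exists_aut_localAction_eq hM hΔ col i (f : Equiv.Perm (X i))
  refine ⟨⟨g, fun j d => ?_⟩, Subtype.ext (h1 c)⟩
  by_cases hj : j = i
  · subst hj
    rw [h1]
    exact f.2
  · rw [h2 j hj]
    exact one_mem _

/-- The elements of the universal group whose local action at `c` lies in a given subgroup
containing all point stabilisers. -/
def localActionComap {M : CoxeterMatrix I} (hΔ : Δ.IsBuilding M) (col : LegalColouring Δ X)
    (F : (i : I) → Subgroup (Equiv.Perm (X i))) (i : I) (c : C) (T : Subgroup (F i))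
    (hT : plusSubgroup (F i) ≤ T) : Subgroup (col.universalGroup F) :=
  -- The local action of a product evaluates its left factor at a moved chamber, so membership in T
  -- must not depend on the chamber.
  have key : ∀ (g : col.universalGroup F) (d : C), col.localActionIn g i c ∈ T →
      col.localActionIn g i d ∈ T := fun g d h => by
    have := mul_mem h (hT (col.inv_localActionIn_mul_mem hΔ g i c d))
    rwa [mul_inv_cancel_left] at this
  { carrier := {g | col.localActionIn g i c ∈ T}
    one_mem' := by
      rw [Set.mem_ofPred_eq, localActionIn_one]
      exact one_mem T
    mul_mem' := fun {g h} hg hh => by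
      rw [Set.mem_ofPred_eq, localActionIn_mul]
      exact mul_mem (key g _ hg) hh
    inv_mem' := fun {g} hg => by
      have e := col.localActionIn_mul g g⁻¹ i c
      rw [mul_inv_cancel, localActionIn_one] at e
      rw [Set.mem_ofPred_eq, eq_inv_of_mul_eq_one_right e.symm]
      exact inv_mem (key g _ hg) }

/-- The set of elements of the universal group that agree with `g` on the chamber `c` is a
neighbourhood of `g`. -/
theorem setOf_apply_eq_mem_nhds (col : LegalColouring Δ X)
    (F : (i : I) → Subgroup (Equiv.Perm (X i))) (c : C) (g : col.universalGroup F) :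
    {h : col.universalGroup F | ((h : Δ.Aut) : Equiv.Perm C) c = ((g : Δ.Aut) : Equiv.Perm C) c} ∈
      nhds g := by
  rw [nhds_subtype, nhds_subtype, Filter.comap_comap]
  refine ⟨_, (permTopology_hasBasis_nhds ((g : Δ.Aut) : Equiv.Perm C)).mem_of_mem
    (i := {c}) trivial, ?_⟩
  intro h hh
  exact hh c (by simp)

end LegalColouring

theorem mainTheorem6 {I : Type*} [Finite I] (M : CoxeterMatrix I) (hM : M.IsRightAngled)
    {C : Type*} (Δ : ChamberSystem I C) (hΔ : Δ.IsBuilding M)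
    {X : I → Type*} (col : LegalColouring Δ X)
    (F : (i : I) → Subgroup (Equiv.Perm (X i)))
    (h_closed : IsClosed (col.universalGroup F : Set Δ.Aut))
    (h_locallyCompact : LocallyCompactSpace (col.universalGroup F))
    (h_compactlyGenerated : IsCompactlyGeneratedGroup (col.universalGroup F))
    (h_plus : ∀ i : I, IsCompactlyGeneratedGroup (plusSubgroup (F i))) :
    ∀ i : I, IsCompactlyGeneratedGroup (F i) := by
  intro i
  obtain ⟨c⟩ := hΔ.1
  obtain ⟨Q, hQ, hQtop⟩ := h_compactlyGenerated
  obtain ⟨K, hK, hKtop⟩ := h_plus i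
  -- Compactness leaves finitely many representatives g, such that every q in Q agrees with one of
  -- them on c.
  obtain ⟨s, -, hs⟩ := hQ.elim_nhds_subcover _ fun g _ => col.setOf_apply_eq_mem_nhds F c g
  refine ⟨(Subtype.val '' K) ∪ ((fun g => col.localActionIn g i c) '' (s : Set _)),
    (hK.image continuous_subtype_val).union (s.finite_toSet.image _).isCompact, ?_⟩
  set T := Subgroup.closure ((Subtype.val '' K) ∪ ((fun g => col.localActionIn g i c) '' (s : Set _)))
    with hTdef
  have hT : plusSubgroup (F i) ≤ T := by
    have : (Subgroup.closure K).map (plusSubgroup (F i)).subtype ≤ T := by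
      rw [MonoidHom.map_closure]
      exact Subgroup.closure_mono Set.subset_union_left
    rwa [hKtop, ← MonoidHom.range_eq_map, Subgroup.range_subtype] at this
  have hQT : Q ⊆ col.localActionComap hΔ F i c T hT := by
    intro q hq
    obtain ⟨g, hg, hqg⟩ := Set.mem_iUnion₂.1 (hs hq)
    have hgT : col.localActionIn g i c ∈ T :=
      Subgroup.subset_closure (Or.inr ⟨g, hg, rfl⟩)
    -- Since q and g agree on c, their local actions there agree on the colour of c, and the
    -- quotient fixes that colour.
    have hmem : (col.localActionIn g i c)⁻¹ * col.localActionIn q i c ∈ plusSubgroup (F i) := by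
      refine mem_plusSubgroup_of_apply_eq_self (x := col.color i c) ?_
      have e1 : col.localAction q i c (col.color i c) = col.color i (((q : Δ.Aut) : Equiv.Perm C) c) :=
        col.localAction_color q i c c ((Δ.adj i).refl c)
      have e2 : col.localAction g i c (col.color i c) = col.color i (((g : Δ.Aut) : Equiv.Perm C) c) :=
        col.localAction_color g i c c ((Δ.adj i).refl c)
      change (col.localAction g i c)⁻¹ (col.localAction q i c (col.color i c)) = _
      exact Equiv.Perm.inv_eq_iff_eq.2 (by rw [e1, e2, hqg])
    have := mul_mem hgT (hT hmem)
    rw [mul_inv_cancel_left] at this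
    exact this
  have htop : col.localActionComap hΔ F i c T hT = ⊤ := by
    rw [eq_top_iff, ← hQtop, Subgroup.closure_le]
    exact hQT
  rw [eq_top_iff]
  intro f _
  obtain ⟨g, rfl⟩ := col.exists_localActionIn_eq hM hΔ F i c f
  have : g ∈ col.localActionComap hΔ F i c T hT := by rw [htop]; trivial
  exact this
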